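/- The set of real roots of the equation $2\cos(\sqrt3\,x)=-e^{-3x}$ is infinite, consists of positive numbers, and can be enumerated as a strictly increasing sequence $r_0<r_1<r_2<\cdots$ (which is then unique). With this enumeration, $$\sum_{n=0}^\infty r_n^{-6}=\frac85 .$$ Moreover, put $\alpha=e^{2\pi i/3}$ and $f(z)=2e^{3z}\cos(\sqrt3\,z)+1$ for $z\in\mathbb C$. Then the set of complex zeros of $f$ is exactly $$\{z\in\mathbb C: f(z)=0\}=\{\,r_n,\ \alpha r_n,\ \alpha^2 r_n : n=0,1,2,\dots\},$$ and every zero of $f$ is simple (of order exactly $1$). -/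

import Mathlib

/-- The entire function `f(z) = 2 e^{3z} cos(√3 z) + 1`. -/
noncomputable def cosExpFun (z : ℂ) : ℂ :=
  2 * Complex.exp (3 * z) * Complex.cos ((Real.sqrt 3 : ℂ) * z) + 1

/-- The primitive cube root of unity `α = e^{2πi/3}`. -/
noncomputable def cubeRootUnity : ℂ :=
  Complex.exp (2 * (Real.pi : ℂ) * Complex.I / 3)

/-! Write F for `expCubeSum`. Then f(z) = e^{2z} F(z) and F(αz) = F(z), so f and F share their zeros
and these are permuted by rotation through α. Every orbit meets the sector |arg z| ≤ π/3, where Re z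
> 0 and |e^{-3z}| < 1; there 2cos(√3 z) = -e^{-3z} forces z to be real
(`im_eq_zero_of_cosExpFun_eq_zero`). The real roots are positive, exactly one in each interval
(nπ/√3, (n+1)π/√3) (`existsUnique_root`). A double zero would lie on the imaginary axis, which
contains no rotated root.

For the sum, F'/F is bounded by 20 on the circles |z| = mπ/√3, and these stay at distance at least
1/4 from all zeros. A Cauchy estimate then shows that (F'/F)^{(5)}(0) = -5! Σ ρ^{-6} over all zeros
ρ. As α⁶ = 1, each rₙ contributes 3rₙ^{-6}; the derivative is -576, so the sum is 576/360 = 8/5. -/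

/-! ### Power sums of zeros from the logarithmic derivative -/

/-- An entire function is divisible by the product of `z - ρ` over finitely many of its zeros. -/
theorem exists_differentiable_eq_mul_prod_sub {g : ℂ → ℂ} (hg : Differentiable ℂ g)
    (S : Finset ℂ) (hS : ∀ ρ ∈ S, g ρ = 0) :
    ∃ Q : ℂ → ℂ, Differentiable ℂ Q ∧ ∀ z, g z = Q z * ∏ ρ ∈ S, (z - ρ) := by
  classical
  induction S using Finset.induction_on with
  | empty => exact ⟨g, hg, by simp⟩
  | insert a S ha ih =>
    obtain ⟨Q, hQ, h⟩ := ih fun ρ hρ => hS ρ (Finset.mem_insert_of_mem hρ)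
    have hQa : Q a = 0 := by
      have h1 := h a
      rw [hS a (Finset.mem_insert_self _ _)] at h1
      refine (mul_eq_zero.1 h1.symm).resolve_right (Finset.prod_ne_zero_iff.2 fun ρ hρ => ?_)
      exact sub_ne_zero.2 fun e => ha (e ▸ hρ)
    refine ⟨dslope Q a, ?_, fun z => ?_⟩
    · rw [← differentiableOn_univ] at hQ ⊢
      exact (Complex.differentiableOn_dslope Filter.univ_mem).2 hQ
    · have h2 := sub_smul_dslope Q a z
      rw [hQa, sub_zero, smul_eq_mul] at h2
      rw [Finset.prod_insert ha, h, ← h2]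
      ring

theorem ne_zero_of_eq_mul_prod_sub {g Q : ℂ → ℂ} (hQ : Differentiable ℂ Q) {S : Finset ℂ}
    (h : ∀ z, g z = Q z * ∏ ρ ∈ S, (z - ρ)) {a : ℂ} (ha : a ∈ S) (hd : deriv g a ≠ 0) :
    Q a ≠ 0 := by
  classical
  intro hQa
  apply hd
  have hg : g = fun z => Q z * ∏ ρ ∈ S, (z - ρ) := funext h
  have hp : DifferentiableAt ℂ (fun z : ℂ => ∏ ρ ∈ S, (z - ρ)) a := by fun_prop
  rw [hg, deriv_fun_mul (hQ a) hp, hQa, Finset.prod_eq_zero ha (sub_self a)]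
  simp

theorem iteratedDeriv_inv_sub_zero (n : ℕ) (ρ : ℂ) :
    iteratedDeriv n (fun z : ℂ => (z - ρ)⁻¹) 0 = -(n.factorial : ℂ) * (ρ ^ (n + 1))⁻¹ := by
  have h := congrFun (iter_deriv_inv_linear_sub n (1 : ℂ) ρ) 0
  rw [iteratedDeriv_eq_iterate]
  simp only [one_mul] at h
  rw [h]
  have e : (-1 - (n : ℤ)) = -((n + 1 : ℕ) : ℤ) := by push_cast; ring
  have e2 : ((-ρ) ^ (n + 1))⁻¹ = -(-1) ^ n * (ρ ^ (n + 1))⁻¹ := by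
    rw [neg_pow, mul_inv, ← inv_pow, inv_neg, inv_one, pow_succ]
    ring
  rw [e, zpow_neg, zpow_natCast, zero_sub, one_pow, mul_one, e2]
  have : ((-1 : ℂ) ^ n) * (-1) ^ n = 1 := by rw [← mul_pow]; simp
  linear_combination (-(n.factorial : ℂ) * (ρ ^ (n + 1))⁻¹) * this

theorem logDeriv_eq_of_eq_mul_prod_sub {g Q : ℂ → ℂ} (hQ : Differentiable ℂ Q) {S : Finset ℂ}
    (h : ∀ z, g z = Q z * ∏ ρ ∈ S, (z - ρ)) {z : ℂ} (hz : g z ≠ 0) :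
    logDeriv Q z = logDeriv g z - ∑ ρ ∈ S, (z - ρ)⁻¹ := by
  have hg : g = fun z => Q z * ∏ ρ ∈ S, (z - ρ) := funext h
  have h0 := hz
  rw [h] at h0
  obtain ⟨h1, h2⟩ := mul_ne_zero_iff.1 h0
  have hp : DifferentiableAt ℂ (fun z : ℂ => ∏ ρ ∈ S, (z - ρ)) z := by fun_prop
  have e : logDeriv (fun z : ℂ => ∏ ρ ∈ S, (z - ρ)) z = ∑ ρ ∈ S, (z - ρ)⁻¹ := by
    have h3 := logDeriv_prod (s := S) (f := fun (ρ z : ℂ) => z - ρ) (x := z)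
      (fun i hi => Finset.prod_ne_zero_iff.1 h2 i hi) (fun i _ => by fun_prop)
    rw [h3]
    refine Finset.sum_congr rfl fun ρ _ => ?_
    simp [logDeriv_apply]
  rw [hg, logDeriv_mul z h1 h2 (hQ z) hp, e]
  ring

/-- A quantitative residue theorem for `g'(z) / (g(z) z ^ (n + 1))` on a disc in which all zeros
of `g` are simple. -/
theorem norm_iteratedDeriv_logDeriv_add_sum_le {g : ℂ → ℂ} (hg : Differentiable ℂ g)
    (hg0 : g 0 ≠ 0) (n : ℕ) {R C d : ℝ} (hR : 0 < R) (hd : 0 < d) (S : Finset ℂ)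
    (hS : ∀ ρ ∈ S, g ρ = 0 ∧ deriv g ρ ≠ 0)
    (hall : ∀ z, ‖z‖ ≤ R → g z = 0 → z ∈ S)
    (hC : ∀ z, ‖z‖ = R → g z ≠ 0 ∧ ‖logDeriv g z‖ ≤ C)
    (hdist : ∀ z, ‖z‖ = R → ∀ ρ ∈ S, d ≤ ‖z - ρ‖) :
    ‖iteratedDeriv n (logDeriv g) 0 + n.factorial * ∑ ρ ∈ S, (ρ ^ (n + 1))⁻¹‖ ≤
      n.factorial * (C + S.card / d) / R ^ n := by
  obtain ⟨Q, hQ, h⟩ := exists_differentiable_eq_mul_prod_sub hg S fun ρ hρ => (hS ρ hρ).1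
  have hQ0 : ∀ z, ‖z‖ ≤ R → Q z ≠ 0 := by
    intro z hz
    by_cases hzS : z ∈ S
    · exact ne_zero_of_eq_mul_prod_sub hQ h hzS (hS z hzS).2
    · intro e
      exact hzS (hall z hz (by rw [h, e, zero_mul]))
  have hρ0 : ∀ ρ ∈ S, (0 : ℂ) - ρ ≠ 0 := by
    rintro ρ hρ e
    have : ρ = 0 := by simpa using e
    exact hg0 (this ▸ (hS ρ hρ).1)
  have hQ' : Differentiable ℂ (deriv Q) := hQ.contDiff.differentiable_deriv_two
  have hg' : Differentiable ℂ (deriv g) := hg.contDiff.differentiable_deriv_two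
  -- With the zeros divided out, `logDeriv Q` is holomorphic on the closed disc, so Cauchy's
  -- estimate for derivatives replaces a contour integral.
  have hdiff : DiffContOnCl ℂ (logDeriv Q) (Metric.ball 0 R) := by
    apply DifferentiableOn.diffContOnCl
    intro z hz
    rw [closure_ball _ hR.ne', mem_closedBall_zero_iff] at hz
    exact ((hQ' z).div (hQ z) (hQ0 z hz)).differentiableWithinAt
  have hbound : ∀ z ∈ Metric.sphere (0 : ℂ) R, ‖logDeriv Q z‖ ≤ C + S.card / d := by
    intro z hz
    rw [mem_sphere_zero_iff_norm] at hz
    obtain ⟨h1, h2⟩ := hC z hz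
    rw [logDeriv_eq_of_eq_mul_prod_sub hQ h h1]
    refine (norm_sub_le _ _).trans (add_le_add h2 ?_)
    refine (norm_sum_le _ _).trans ?_
    rw [div_eq_mul_inv, ← nsmul_eq_mul]
    refine Finset.sum_le_card_nsmul _ _ _ fun ρ hρ => ?_
    rw [norm_inv]
    exact inv_anti₀ hd (hdist z hz ρ hρ)
  have hmain := Complex.norm_iteratedDeriv_le_of_forall_mem_sphere_norm_le n hR hdiff hbound
  have hev : logDeriv Q =ᶠ[nhds 0] fun z => logDeriv g z - ∑ ρ ∈ S, (z - ρ)⁻¹ := by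
    filter_upwards [hg.continuous.continuousAt.eventually_ne hg0] with z hz
    exact logDeriv_eq_of_eq_mul_prod_sub hQ h hz
  have hA : ContDiffAt ℂ n (logDeriv g) 0 := hg'.contDiff.contDiffAt.div hg.contDiff.contDiffAt hg0
  have hB : ∀ ρ ∈ S, ContDiffAt ℂ n (fun z : ℂ => (z - ρ)⁻¹) 0 := fun ρ hρ =>
    (contDiffAt_id.sub contDiffAt_const).inv (hρ0 ρ hρ)
  rw [hev.iteratedDeriv_eq, iteratedDeriv_fun_sub hA (ContDiffAt.sum hB),
    iteratedDeriv_fun_sum hB] at hmain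
  simp only [iteratedDeriv_inv_sub_zero] at hmain
  rw [← Finset.mul_sum, neg_mul, sub_neg_eq_add] at hmain
  exact hmain

/-! ### Threefold symmetry -/

/-- The sum `e^{-2z} + e^{-2αz} + e^{-2α²z}` over the cube roots of unity. -/
noncomputable def expCubeSum (z : ℂ) : ℂ :=
  Complex.exp (-2 * z) + Complex.exp (-2 * cubeRootUnity * z) +
    Complex.exp (-2 * cubeRootUnity ^ 2 * z)

theorem sqrt_three_sq : (Real.sqrt 3 : ℂ) ^ 2 = 3 := by
  rw [← Complex.ofReal_pow, Real.sq_sqrt (by norm_num)]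
  norm_num

theorem cubeRootUnity_eq : cubeRootUnity = -1 / 2 + Real.sqrt 3 / 2 * Complex.I := by
  have h : (2 * (Real.pi : ℂ) * Complex.I / 3) = ((Real.pi - Real.pi / 3 : ℝ) : ℂ) * Complex.I := by
    push_cast
    ring
  rw [cubeRootUnity, h, Complex.exp_mul_I, ← Complex.ofReal_cos, ← Complex.ofReal_sin,
    Real.cos_pi_sub, Real.sin_pi_sub, Real.cos_pi_div_three, Real.sin_pi_div_three]
  push_cast
  ring

theorem cubeRootUnity_sq : cubeRootUnity ^ 2 = -1 / 2 - Real.sqrt 3 / 2 * Complex.I := by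
  rw [cubeRootUnity_eq]
  linear_combination (Complex.I ^ 2 / 4) * sqrt_three_sq + (3 / 4 : ℂ) * Complex.I_sq

theorem cubeRootUnity_pow_three : cubeRootUnity ^ 3 = 1 := by
  rw [cubeRootUnity, ← Complex.exp_nat_mul, Complex.exp_eq_one_iff]
  exact ⟨1, by push_cast; ring⟩

theorem norm_cubeRootUnity : ‖cubeRootUnity‖ = 1 :=
  Complex.norm_eq_one_of_pow_eq_one cubeRootUnity_pow_three (by norm_num)

/-- The exponents match because 2 - 2α = 3 - i√3 and 2 - 2α² = 3 + i√3. -/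
theorem cosExpFun_eq (z : ℂ) : cosExpFun z = Complex.exp (2 * z) * expCubeSum z := by
  have h1 : Complex.exp (2 * z) * Complex.exp (-2 * z) = 1 := by
    rw [← Complex.exp_add]; simp
  have h2 : Complex.exp (2 * z) * Complex.exp (-2 * cubeRootUnity * z) =
      Complex.exp (3 * z) * Complex.exp (-(Real.sqrt 3 * z) * Complex.I) := by
    rw [← Complex.exp_add, ← Complex.exp_add, cubeRootUnity_eq]
    congr 1; ring
  have h3 : Complex.exp (2 * z) * Complex.exp (-2 * cubeRootUnity ^ 2 * z) =
      Complex.exp (3 * z) * Complex.exp ((Real.sqrt 3 * z) * Complex.I) := by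
    rw [← Complex.exp_add, ← Complex.exp_add, cubeRootUnity_sq]
    congr 1; ring
  rw [cosExpFun, expCubeSum, Complex.cos, mul_add, mul_add, h1, h2, h3]
  ring

theorem cosExpFun_eq_zero_iff (z : ℂ) : cosExpFun z = 0 ↔ expCubeSum z = 0 := by
  rw [cosExpFun_eq]
  simp [Complex.exp_ne_zero]

theorem expCubeSum_cubeRootUnity_mul (z : ℂ) : expCubeSum (cubeRootUnity * z) = expCubeSum z := by
  have h1 : -2 * cubeRootUnity * (cubeRootUnity * z) = -2 * cubeRootUnity ^ 2 * z := by ring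
  have h2 : -2 * cubeRootUnity ^ 2 * (cubeRootUnity * z) = -2 * z := by
    linear_combination (-2 * z) * cubeRootUnity_pow_three
  rw [expCubeSum, expCubeSum, h1, h2, ← mul_assoc]
  ring

theorem expCubeSum_pow_mul (k : ℕ) (z : ℂ) :
    expCubeSum (cubeRootUnity ^ k * z) = expCubeSum z := by
  induction k with
  | zero => simp
  | succ k ih => rw [pow_succ', mul_assoc, expCubeSum_cubeRootUnity_mul, ih]

theorem differentiable_expCubeSum : Differentiable ℂ expCubeSum := by
  unfold expCubeSum
  fun_prop

theorem expCubeSum_zero : expCubeSum 0 = 3 := by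
  norm_num [expCubeSum]

theorem deriv_expCubeSum_pow_mul (k : ℕ) (z : ℂ) :
    cubeRootUnity ^ k * deriv expCubeSum (cubeRootUnity ^ k * z) = deriv expCubeSum z := by
  have h : (fun w => expCubeSum (cubeRootUnity ^ k * w)) = expCubeSum :=
    funext (expCubeSum_pow_mul k)
  have h2 := deriv_comp_mul_left (cubeRootUnity ^ k) expCubeSum z
  rw [h] at h2
  exact h2.symm

/-- Some rotation of `z` by a cube root of unity lies in the sector `|arg z| ≤ π / 3`. -/
theorem exists_norm_le_two_mul_re (z : ℂ) :
    ∃ k < 3, ‖z‖ ≤ 2 * (cubeRootUnity ^ k * z).re := by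
  by_contra! h
  have h0 := h 0 (by norm_num)
  have h1 := h 1 (by norm_num)
  have h2 := h 2 (by norm_num)
  rw [pow_one, cubeRootUnity_eq] at h1
  rw [cubeRootUnity_sq] at h2
  have hs : Real.sqrt 3 ^ 2 = 3 := Real.sq_sqrt (by norm_num)
  have hn : ‖z‖ ^ 2 = z.re ^ 2 + z.im ^ 2 := by
    rw [← Complex.normSq_eq_norm_sq, Complex.normSq_apply]; ring
  have hn0 := norm_nonneg z
  simp at h0 h1 h2
  set x := z.re
  set y := z.im
  set s := ‖z‖
  set q := Real.sqrt 3
  have a1 : q * y < s + x := by linarith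
  have a2 : -(q * y) < s + x := by linarith
  -- Since y² = (s - x)(s + x), this becomes 3(s - x) < s + x, that is s < 2x, against `h0`.
  have a3 : q ^ 2 * y ^ 2 < (s + x) ^ 2 := by nlinarith
  rw [hs] at a3
  nlinarith

theorem eq_or_of_pow_mul_eq {k : ℕ} (hk : k < 3) {z w : ℂ} (h : cubeRootUnity ^ k * z = w) :
    z = w ∨ z = cubeRootUnity * w ∨ z = cubeRootUnity ^ 2 * w := by
  subst h
  have h3 := cubeRootUnity_pow_three
  interval_cases k
  · left; simp
  · right; right; linear_combination (-z) * h3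
  · right; left; linear_combination (-z) * h3

/-! ### Zeros in the right half-plane are real -/

theorem cos_eq_mk (w : ℂ) : Complex.cos w =
    ⟨Real.cos w.re * Real.cosh w.im, -(Real.sin w.re * Real.sinh w.im)⟩ := by
  rw [Complex.cos_eq, Complex.mk_eq_add_mul_I]
  push_cast
  ring

theorem norm_sq_cos (w : ℂ) : ‖Complex.cos w‖ ^ 2 = Real.cos w.re ^ 2 + Real.sinh w.im ^ 2 := by
  rw [← Complex.normSq_eq_norm_sq, Complex.normSq_apply, cos_eq_mk]
  have h1 := Real.sin_sq_add_cos_sq w.re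
  have h2 := Real.cosh_sq w.im
  linear_combination (Real.cos w.re ^ 2) * h2 + (Real.sinh w.im ^ 2) * h1

theorem cosExpFun_eq_zero_iff' (z : ℂ) :
    cosExpFun z = 0 ↔ 2 * Complex.cos (Real.sqrt 3 * z) = -Complex.exp (-3 * z) := by
  have h : Complex.exp (3 * z) * Complex.exp (-3 * z) = 1 := by
    rw [← Complex.exp_add]; simp
  have h' := Complex.exp_ne_zero (3 * z)
  unfold cosExpFun
  constructor
  · intro h2
    apply mul_left_cancel₀ h'
    linear_combination h2 + h
  · intro h2
    linear_combination Complex.exp (3 * z) * h2 - h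

theorem cosExpFun_ofReal_eq_zero_iff (x : ℝ) :
    cosExpFun x = 0 ↔ 2 * Real.cos (Real.sqrt 3 * x) = -Real.exp (-3 * x) := by
  rw [cosExpFun_eq_zero_iff']
  exact_mod_cast Iff.rfl

theorem sq_le_sinh_sq (x : ℝ) : x ^ 2 ≤ Real.sinh x ^ 2 := by
  rw [← sq_abs x, ← sq_abs (Real.sinh x), Real.abs_sinh]
  exact pow_le_pow_left₀ (abs_nonneg x) (Real.self_le_sinh_iff.2 (abs_nonneg x)) 2

/-- Let E = e^{-3 Re z} < 1, and let c, s be the cosine and sine of √3 Re z. If y = Im z ≠ 0, the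
real parts give 4c² ≤ E² as cosh ≥ 1, and the imaginary parts give 4s² ≤ 3E² as sinh²(√3y) ≥ 3y² and
sin²(3y) ≤ 9y². Adding, 4 ≤ 4E² < 4. -/
theorem im_eq_zero_of_cosExpFun_eq_zero {z : ℂ} (hz : 0 < z.re) (h : cosExpFun z = 0) :
    z.im = 0 := by
  rw [cosExpFun_eq_zero_iff'] at h
  by_contra hy
  have hre := congrArg Complex.re h
  have him := congrArg Complex.im h
  rw [cos_eq_mk] at hre him
  simp [Complex.exp_re, Complex.exp_im] at hre him
  have hE : Real.exp (-(3 * z.re)) < 1 := by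
    rw [Real.exp_lt_one_iff]; linarith
  have hE0 := Real.exp_pos (-(3 * z.re))
  have hs : Real.sqrt 3 ^ 2 = 3 := Real.sq_sqrt (by norm_num)
  have hsinh := sq_le_sinh_sq (Real.sqrt 3 * z.im)
  have hsin : Real.sin (3 * z.im) ^ 2 ≤ (3 * z.im) ^ 2 := by
    rw [← sq_abs, ← sq_abs (3 * z.im)]
    exact pow_le_pow_left₀ (abs_nonneg _) Real.abs_sin_le_abs 2
  have hcos := Real.cos_sq_le_one (3 * z.im)
  have h1 := Real.sin_sq_add_cos_sq (Real.sqrt 3 * z.re)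
  have h2 := Real.cosh_sq (Real.sqrt 3 * z.im)
  set E := Real.exp (-(3 * z.re))
  set y := z.im
  set s := Real.sin (Real.sqrt 3 * z.re)
  set c := Real.cos (Real.sqrt 3 * z.re)
  have hy2 : 0 < y ^ 2 := by positivity
  have k1 : 4 * c ^ 2 ≤ E ^ 2 := by
    have e : 4 * c ^ 2 * Real.cosh (Real.sqrt 3 * y) ^ 2 = E ^ 2 * Real.cos (3 * y) ^ 2 := by
      linear_combination (2 * c * Real.cosh (Real.sqrt 3 * y) - E * Real.cos (3 * y)) * hre
    nlinarith [sq_nonneg c, sq_nonneg E, sq_nonneg (Real.sinh (Real.sqrt 3 * y)),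
      mul_nonneg (sq_nonneg c) (sq_nonneg (Real.sinh (Real.sqrt 3 * y)))]
  have k2 : 4 * s ^ 2 ≤ 3 * E ^ 2 := by
    have e : 4 * s ^ 2 * Real.sinh (Real.sqrt 3 * y) ^ 2 = E ^ 2 * Real.sin (3 * y) ^ 2 := by
      linear_combination (-2 * s * Real.sinh (Real.sqrt 3 * y) + E * Real.sin (3 * y)) * him
    have e1 : 4 * s ^ 2 * (3 * y ^ 2) ≤ E ^ 2 * (3 * y) ^ 2 := by
      calc _ = 4 * s ^ 2 * (Real.sqrt 3 * y) ^ 2 := by rw [mul_pow, hs]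
        _ ≤ 4 * s ^ 2 * Real.sinh (Real.sqrt 3 * y) ^ 2 := by gcongr
        _ ≤ _ := by rw [e]; gcongr
    have e2 : (3 * y ^ 2) * (4 * s ^ 2) ≤ (3 * y ^ 2) * (3 * E ^ 2) := by linarith
    exact le_of_mul_le_mul_left e2 (by positivity)
  nlinarith

/-! ### The real roots -/

theorem sqrt_three_le_two : Real.sqrt 3 ≤ 2 := by
  rw [Real.sqrt_le_left (by norm_num)]; norm_num

theorem cosExpFun_ofReal_ne_zero_of_nonpos {x : ℝ} (hx : x ≤ 0) : cosExpFun x ≠ 0 := by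
  intro h
  rw [cosExpFun_ofReal_eq_zero_iff] at h
  have h1 := Real.add_one_le_exp (-3 * x)
  have h2 := Real.neg_one_le_cos (Real.sqrt 3 * x)
  have hs := sqrt_three_le_two
  have hs0 := Real.sqrt_nonneg 3
  have h3 : -1 / 3 ≤ x := by linarith
  have h4 : 0 < Real.cos (Real.sqrt 3 * x) := by
    apply Real.cos_pos_of_mem_Ioo
    have := Real.pi_gt_three
    constructor <;> nlinarith
  have h5 := Real.exp_pos (-3 * x)
  linarith

/-- The derivative is -2e^{√3t} sin(t - π/3). -/
theorem strictAntiOn_exp_mul_cos :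
    StrictAntiOn (fun t => Real.exp (Real.sqrt 3 * t) * Real.cos t)
      (Set.Icc (Real.pi / 3) Real.pi) := by
  apply strictAntiOn_of_deriv_neg (convex_Icc _ _) (by fun_prop)
  intro t ht
  rw [interior_Icc] at ht
  have hd : HasDerivAt (fun t => Real.exp (Real.sqrt 3 * t) * Real.cos t)
      (Real.exp (Real.sqrt 3 * t) * (Real.sqrt 3 * 1) * Real.cos t +
        Real.exp (Real.sqrt 3 * t) * (-Real.sin t)) t :=
    (((hasDerivAt_id t).const_mul _).exp).mul (Real.hasDerivAt_cos t)
  rw [hd.deriv]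
  have h1 : 0 < Real.sin (t - Real.pi / 3) := by
    apply Real.sin_pos_of_pos_of_lt_pi <;> linarith [ht.1, ht.2, Real.pi_pos]
  rw [Real.sin_sub, Real.cos_pi_div_three, Real.sin_pi_div_three] at h1
  have h2 := Real.exp_pos (Real.sqrt 3 * t)
  nlinarith

theorem existsUnique_exp_mul_cos_eq {v : ℝ} (hv : |v| ≤ 1 / 2) :
    ∃! t, t ∈ Set.Ioo 0 Real.pi ∧ Real.exp (Real.sqrt 3 * t) * Real.cos t = v := by
  obtain ⟨hv1, hv2⟩ := abs_le.1 hv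
  -- Before π/3 the function exceeds 1/2, so all solutions lie where it is strictly decreasing.
  have hlow : ∀ t, t ∈ Set.Ioo 0 Real.pi ∧ Real.exp (Real.sqrt 3 * t) * Real.cos t = v →
      t ∈ Set.Icc (Real.pi / 3) Real.pi := by
    rintro t ⟨ht, e⟩
    refine ⟨?_, ht.2.le⟩
    by_contra! hlt
    have h1 : 1 / 2 < Real.cos t := by
      rw [← Real.cos_pi_div_three]
      exact Real.cos_lt_cos_of_nonneg_of_le_pi ht.1.le (by linarith [Real.pi_pos]) hlt
    have h2 : 1 ≤ Real.exp (Real.sqrt 3 * t) :=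
      Real.one_le_exp (mul_nonneg (Real.sqrt_nonneg 3) ht.1.le)
    nlinarith
  have hc : ContinuousOn (fun t => Real.exp (Real.sqrt 3 * t) * Real.cos t)
    (Set.Icc 0 Real.pi) := by fun_prop
  have hex := intermediate_value_Ioo' Real.pi_pos.le hc
  have hmem : v ∈ Set.Ioo (Real.exp (Real.sqrt 3 * Real.pi) * Real.cos Real.pi)
      (Real.exp (Real.sqrt 3 * 0) * Real.cos 0) := by
    have h2 : 1 ≤ Real.exp (Real.sqrt 3 * Real.pi) :=
      Real.one_le_exp (mul_nonneg (Real.sqrt_nonneg 3) Real.pi_pos.le)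
    simp only [Real.cos_pi, mul_zero, Real.exp_zero, Real.cos_zero, Set.mem_Ioo]
    constructor <;> linarith
  obtain ⟨t, ht, e⟩ := hex hmem
  refine ⟨t, ⟨ht, e⟩, fun t' ht' => ?_⟩
  exact strictAntiOn_exp_mul_cos.injOn (hlow t' ht') (hlow t ⟨ht, e⟩) (ht'.2.trans e.symm)

theorem existsUnique_root (n : ℕ) :
    ∃! x : ℝ, x ∈ Set.Ioo (n * (Real.pi / Real.sqrt 3)) ((n + 1) * (Real.pi / Real.sqrt 3)) ∧
      cosExpFun x = 0 := by
  have hs : 0 < Real.sqrt 3 := by positivity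
  have hss : Real.sqrt 3 * Real.sqrt 3 = 3 := Real.mul_self_sqrt (by norm_num)
  have hv : |-(-1) ^ n * Real.exp (-(Real.sqrt 3 * (n * Real.pi))) / 2| ≤ 1 / 2 := by
    rw [abs_div, abs_mul, abs_neg, abs_pow, abs_neg, abs_one, one_pow, one_mul, Real.abs_exp]
    have : Real.exp (-(Real.sqrt 3 * (n * Real.pi))) ≤ 1 := by
      rw [Real.exp_le_one_iff]
      have := Real.pi_pos
      simp only [Left.neg_nonpos_iff]
      positivity
    norm_num
    linarith
  -- The substitution t = √3x - nπ moves every interval to (0, π); n survives only in the right-hand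
  -- side.
  have key : ∀ x : ℝ, (x ∈ Set.Ioo (n * (Real.pi / Real.sqrt 3)) ((n + 1) * (Real.pi / Real.sqrt 3)) ∧
      cosExpFun x = 0) ↔ (Real.sqrt 3 * x - n * Real.pi ∈ Set.Ioo 0 Real.pi ∧
      Real.exp (Real.sqrt 3 * (Real.sqrt 3 * x - n * Real.pi)) *
        Real.cos (Real.sqrt 3 * x - n * Real.pi) =
        -(-1) ^ n * Real.exp (-(Real.sqrt 3 * (n * Real.pi))) / 2) := by
    intro x
    refine and_congr ?_ ?_
    · rw [Set.mem_Ioo, Set.mem_Ioo, ← mul_div_assoc, ← mul_div_assoc, div_lt_iff₀ hs,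
        lt_div_iff₀ hs]
      constructor <;> rintro ⟨h1, h2⟩ <;> constructor <;> linarith
    · rw [cosExpFun_ofReal_eq_zero_iff, Real.cos_sub_nat_mul_pi]
      have e1 : Real.exp (Real.sqrt 3 * (Real.sqrt 3 * x - n * Real.pi)) =
          Real.exp (3 * x) * Real.exp (-(Real.sqrt 3 * (n * Real.pi))) := by
        rw [← Real.exp_add]
        congr 1
        linear_combination x * hss
      have e2 : Real.exp (3 * x) * Real.exp (-3 * x) = 1 := by
        rw [← Real.exp_add]; simp
      have e4 := Real.exp_ne_zero (-(Real.sqrt 3 * (n * Real.pi)))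
      have e6 := Real.exp_ne_zero (3 * x)
      have e7 : ((-1 : ℝ) ^ n) ≠ 0 := pow_ne_zero _ (by norm_num)
      rw [e1]
      constructor
      · intro h
        linear_combination (Real.exp (3 * x) * Real.exp (-(Real.sqrt 3 * (n * Real.pi))) *
          (-1) ^ n / 2) * h - (Real.exp (-(Real.sqrt 3 * (n * Real.pi))) * (-1) ^ n / 2) * e2
      · intro h
        apply mul_left_cancel₀ (mul_ne_zero e6 (mul_ne_zero e4 e7))
        linear_combination 2 * h + (Real.exp (-(Real.sqrt 3 * (n * Real.pi))) * (-1) ^ n) * e2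
  obtain ⟨t, ht, hu⟩ := existsUnique_exp_mul_cos_eq hv
  have ht' : Real.sqrt 3 * ((t + n * Real.pi) / Real.sqrt 3) - n * Real.pi = t := by
    field_simp
    ring
  refine ⟨(t + n * Real.pi) / Real.sqrt 3, (key _).2 (by rw [ht']; exact ht), fun y hy => ?_⟩
  have h := hu _ ((key y).1 hy)
  rw [← h]
  field_simp
  ring

/-- The real roots of `2 cos (√3 x) = -e^{-3x}`, in increasing order. -/
noncomputable def realRoot (n : ℕ) : ℝ := (existsUnique_root n).exists.choose

theorem realRoot_mem (n : ℕ) : realRoot n ∈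
    Set.Ioo (n * (Real.pi / Real.sqrt 3)) ((n + 1) * (Real.pi / Real.sqrt 3)) :=
  (existsUnique_root n).exists.choose_spec.1

theorem cosExpFun_realRoot (n : ℕ) : cosExpFun (realRoot n) = 0 :=
  (existsUnique_root n).exists.choose_spec.2

theorem pi_div_sqrt_three_pos : 0 < Real.pi / Real.sqrt 3 := by
  have := Real.pi_pos
  positivity

theorem realRoot_pos (n : ℕ) : 0 < realRoot n :=
  lt_of_le_of_lt (mul_nonneg n.cast_nonneg pi_div_sqrt_three_pos.le) (realRoot_mem n).1

theorem strictMono_realRoot : StrictMono realRoot := by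
  refine strictMono_nat_of_lt_succ fun n => ?_
  have h := (realRoot_mem (n + 1)).1
  push_cast at h
  exact (realRoot_mem n).2.trans h

theorem cos_realRoot_sq_lt (n : ℕ) : Real.cos (Real.sqrt 3 * realRoot n) ^ 2 < 1 / 4 := by
  have h := (cosExpFun_ofReal_eq_zero_iff _).1 (cosExpFun_realRoot n)
  have h1 : Real.exp (-3 * realRoot n) < 1 := by
    rw [Real.exp_lt_one_iff]; linarith [realRoot_pos n]
  have h2 := Real.exp_pos (-3 * realRoot n)
  nlinarith

theorem exists_realRoot_eq {x : ℝ} (h : cosExpFun x = 0) : ∃ n, realRoot n = x := by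
  have hx : 0 < x := by
    by_contra! hx
    exact cosExpFun_ofReal_ne_zero_of_nonpos hx h
  have hp := pi_div_sqrt_three_pos
  have h1 := Nat.floor_le (div_nonneg hx.le hp.le)
  have h2 := Nat.lt_floor_add_one (x / (Real.pi / Real.sqrt 3))
  set n := ⌊x / (Real.pi / Real.sqrt 3)⌋₊
  rw [le_div_iff₀ hp] at h1
  rw [div_lt_iff₀ hp] at h2
  -- At an endpoint |2cos| = 2, while e^{-3x} < 1.
  have hne : n * (Real.pi / Real.sqrt 3) ≠ x := by
    intro e
    have h3 := (cosExpFun_ofReal_eq_zero_iff _).1 h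
    have h4 : Real.sqrt 3 * x = n * Real.pi := by
      rw [← e]; field_simp
    have h5 : Real.exp (-3 * x) < 1 := by
      rw [Real.exp_lt_one_iff]; linarith
    have h6 := Real.exp_pos (-3 * x)
    have h7 := Real.abs_cos_int_mul_pi n
    rw [Int.cast_natCast, ← h4] at h7
    rcases abs_eq (by norm_num) |>.1 h7 with h8 | h8 <;> rw [h8] at h3 <;> linarith
  exact ⟨n, (existsUnique_root n).unique ⟨realRoot_mem n, cosExpFun_realRoot n⟩
    ⟨⟨lt_of_le_of_ne h1 hne, h2⟩, h⟩⟩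

theorem range_realRoot : Set.range realRoot =
    {x : ℝ | 2 * Real.cos (Real.sqrt 3 * x) = -Real.exp (-3 * x)} := by
  ext x
  rw [Set.mem_ofPred_eq, ← cosExpFun_ofReal_eq_zero_iff]
  exact ⟨fun ⟨n, hn⟩ => hn ▸ cosExpFun_realRoot n, exists_realRoot_eq⟩

theorem exists_pow_mul_eq_realRoot {z : ℂ} (h : expCubeSum z = 0) :
    ∃ k < 3, ∃ n, cubeRootUnity ^ k * z = realRoot n := by
  obtain ⟨k, hk, hre⟩ := exists_norm_le_two_mul_re z
  have hz : z ≠ 0 := by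
    rintro rfl
    rw [expCubeSum_zero] at h
    norm_num at h
  have hpos : 0 < (cubeRootUnity ^ k * z).re := by
    have := norm_pos_iff.2 hz
    linarith
  have h0 : cosExpFun (cubeRootUnity ^ k * z) = 0 := by
    rw [cosExpFun_eq_zero_iff, expCubeSum_pow_mul, h]
  have him := im_eq_zero_of_cosExpFun_eq_zero hpos h0
  have e : ((cubeRootUnity ^ k * z).re : ℂ) = cubeRootUnity ^ k * z :=
    Complex.ext rfl (by simpa using him.symm)
  rw [← e] at h0
  obtain ⟨n, hn⟩ := exists_realRoot_eq h0
  exact ⟨k, hk, n, by rw [hn, e]⟩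

theorem cosExpFun_eq_zero_iff_exists (z : ℂ) : cosExpFun z = 0 ↔
    ∃ n : ℕ, z = (realRoot n : ℂ) ∨ z = cubeRootUnity * (realRoot n : ℂ) ∨
      z = cubeRootUnity ^ 2 * (realRoot n : ℂ) := by
  constructor
  · intro h
    obtain ⟨k, hk, n, hn⟩ := exists_pow_mul_eq_realRoot ((cosExpFun_eq_zero_iff z).1 h)
    exact ⟨n, eq_or_of_pow_mul_eq hk hn⟩
  · rintro ⟨n, hn⟩
    have h := (cosExpFun_eq_zero_iff _).1 (cosExpFun_realRoot n)
    rw [cosExpFun_eq_zero_iff]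
    rcases hn with rfl | rfl | rfl
    · exact h
    · rw [expCubeSum_cubeRootUnity_mul, h]
    · rw [expCubeSum_pow_mul, h]

/-! ### Simplicity of the zeros -/

theorem hasDerivAt_cosExpFun (z : ℂ) : HasDerivAt cosExpFun
    (2 * Complex.exp (3 * z) *
      (3 * Complex.cos (Real.sqrt 3 * z) - Real.sqrt 3 * Complex.sin (Real.sqrt 3 * z))) z := by
  have h1 : HasDerivAt (fun z : ℂ => Complex.exp (3 * z)) (Complex.exp (3 * z) * (3 * 1)) z :=
    ((hasDerivAt_id z).const_mul 3).cexp
  have h2 : HasDerivAt (fun z : ℂ => Complex.cos (Real.sqrt 3 * z))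
      (-Complex.sin (Real.sqrt 3 * z) * (Real.sqrt 3 * 1)) z :=
    ((hasDerivAt_id z).const_mul (Real.sqrt 3 : ℂ)).ccos
  convert! ((h1.const_mul 2).mul h2).add_const 1 using 1
  ring

/-- If f' also vanished, 3cos = √3 sin would give 4cos² = 1, hence e^{-6z} = 1 and Re z = 0; but the
zeros have real part rₙ or -rₙ/2. -/
theorem deriv_cosExpFun_ne_zero {z : ℂ} (h : cosExpFun z = 0) : deriv cosExpFun z ≠ 0 := by
  rw [(hasDerivAt_cosExpFun z).deriv]
  intro hd
  have hd := (mul_eq_zero.1 hd).resolve_left (mul_ne_zero two_ne_zero (Complex.exp_ne_zero _))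
  have hs := sqrt_three_sq
  have hcos : 4 * Complex.cos (Real.sqrt 3 * z) ^ 2 = 1 := by
    linear_combination (1 / 3 * (3 * Complex.cos (Real.sqrt 3 * z) +
      Real.sqrt 3 * Complex.sin (Real.sqrt 3 * z))) * hd + Complex.sin_sq_add_cos_sq (Real.sqrt 3 * z)
      + 1 / 3 * Complex.sin (Real.sqrt 3 * z) ^ 2 * hs
  have hz := (cosExpFun_eq_zero_iff' z).1 h
  have hexp : Complex.exp (-3 * z) ^ 2 = 1 := by
    linear_combination hcos - (2 * Complex.cos (Real.sqrt 3 * z) - Complex.exp (-3 * z)) * hz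
  have hre : z.re = 0 := by
    have h1 := congrArg norm hexp
    rw [norm_pow, Complex.norm_exp, norm_one, ← Real.exp_nat_mul, Real.exp_eq_one_iff] at h1
    simpa using h1
  obtain ⟨n, hn⟩ := (cosExpFun_eq_zero_iff_exists z).1 h
  have hpos := realRoot_pos n
  rw [cubeRootUnity_sq, cubeRootUnity_eq] at hn
  rcases hn with rfl | rfl | rfl <;> simp at hre <;> linarith

theorem analyticOrderAt_cosExpFun {z : ℂ} (h : cosExpFun z = 0) :
    analyticOrderAt cosExpFun z = 1 := by
  have hd : Differentiable ℂ cosExpFun := fun w => (hasDerivAt_cosExpFun w).differentiableAt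
  exact (hd.analyticAt z).analyticOrderAt_eq_one_of_zero_deriv_ne_zero h (deriv_cosExpFun_ne_zero h)

theorem deriv_cosExpFun_eq (z : ℂ) : deriv cosExpFun z =
    2 * cosExpFun z + Complex.exp (2 * z) * deriv expCubeSum z := by
  have h1 : HasDerivAt (fun z : ℂ => Complex.exp (2 * z)) (Complex.exp (2 * z) * (2 * 1)) z :=
    ((hasDerivAt_id z).const_mul 2).cexp
  have h2 := (h1.mul (differentiable_expCubeSum z).hasDerivAt).deriv
  have h3 : cosExpFun = (fun z : ℂ => Complex.exp (2 * z)) * expCubeSum := funext cosExpFun_eq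
  rw [cosExpFun_eq z, h3, h2]
  ring

theorem deriv_expCubeSum_ne_zero {z : ℂ} (h : expCubeSum z = 0) : deriv expCubeSum z ≠ 0 := by
  intro hd
  have h0 := (cosExpFun_eq_zero_iff z).2 h
  apply deriv_cosExpFun_ne_zero h0
  rw [deriv_cosExpFun_eq, h0, hd]
  ring

/-! ### Bounds on the circles |z| = mπ/√3 -/

theorem half_le_abs_cos {a b : ℝ} (hb : |Real.cos b| = 1) (h : |a - b| ≤ 1 / 2) :
    1 / 2 ≤ |Real.cos a| := by
  have h1 := Real.lipschitzWith_cos.dist_le_mul b a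
  rw [Real.dist_eq, Real.dist_eq, abs_sub_comm b a] at h1
  have h2 := abs_sub_abs_le_abs_sub (Real.cos b) (Real.cos a)
  simp at h1
  linarith

theorem abs_cos_sqrt_three_mul (m : ℕ) :
    |Real.cos (Real.sqrt 3 * (m * (Real.pi / Real.sqrt 3)))| = 1 := by
  have e : Real.sqrt 3 * (m * (Real.pi / Real.sqrt 3)) = ((m : ℤ) : ℝ) * Real.pi := by
    push_cast
    field_simp
  rw [e, Real.abs_cos_int_mul_pi]

/-- |cos(√3x)| is 1 at mπ/√3 and below 1/2 at a root; cosine is 1-Lipschitz and √3 ≤ 2. -/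
theorem quarter_le_abs_sub_realRoot (m n : ℕ) :
    1 / 4 ≤ |m * (Real.pi / Real.sqrt 3) - realRoot n| := by
  by_contra! h
  have h1 := half_le_abs_cos (a := Real.sqrt 3 * realRoot n) (abs_cos_sqrt_three_mul m) (by
    rw [← mul_sub, abs_mul, abs_of_nonneg (Real.sqrt_nonneg 3), abs_sub_comm]
    have := mul_le_mul sqrt_three_le_two h.le (abs_nonneg _) (by norm_num)
    linarith)
  have h2 := cos_realRoot_sq_lt n
  rw [← sq_abs] at h2
  nlinarith

theorem one_le_pi_div_sqrt_three : 1 ≤ Real.pi / Real.sqrt 3 := by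
  rw [le_div_iff₀ (by positivity)]
  linarith [Real.pi_gt_three, sqrt_three_le_two]

/-- Away from the real axis sinh²(√3 Im z) suffices. Near it, Re z is close to |z| = mπ/√3, where
the cosine is ±1. -/
theorem half_le_norm_cos {m : ℕ} (hm : 1 ≤ m) {z : ℂ}
    (hz : ‖z‖ = m * (Real.pi / Real.sqrt 3)) (hre : ‖z‖ ≤ 2 * z.re) :
    1 / 2 ≤ ‖Complex.cos (Real.sqrt 3 * z)‖ := by
  have hR : 1 ≤ ‖z‖ := by
    have hm' : (1 : ℝ) ≤ m := by exact_mod_cast hm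
    rw [hz]
    nlinarith [one_le_pi_div_sqrt_three]
  have h := norm_sq_cos (Real.sqrt 3 * z)
  rw [Complex.re_ofReal_mul, Complex.im_ofReal_mul] at h
  have hs : Real.sqrt 3 ^ 2 = 3 := Real.sq_sqrt (by norm_num)
  have hn : ‖z‖ ^ 2 = z.re ^ 2 + z.im ^ 2 := by
    rw [← Complex.normSq_eq_norm_sq, Complex.normSq_apply]; ring
  suffices 1 / 4 ≤ ‖Complex.cos (Real.sqrt 3 * z)‖ ^ 2 by
    nlinarith [norm_nonneg (Complex.cos (Real.sqrt 3 * z))]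
  rw [h]
  rcases le_or_gt (1 / 4) ((Real.sqrt 3 * z.im) ^ 2) with hy | hy
  · linarith [sq_le_sinh_sq (Real.sqrt 3 * z.im), sq_nonneg (Real.cos (Real.sqrt 3 * z.re))]
  · have h1 : 1 / 2 ≤ |Real.cos (Real.sqrt 3 * z.re)| := by
      apply half_le_abs_cos (abs_cos_sqrt_three_mul m)
      rw [← hz, ← mul_sub, abs_mul, abs_of_nonneg (Real.sqrt_nonneg 3), abs_sub_comm,
        abs_of_nonneg (sub_nonneg.2 (Complex.re_le_norm z))]
      rw [mul_pow, hs] at hy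
      have h2 : ‖z‖ - z.re ≤ 1 / 4 := by nlinarith [Complex.re_le_norm z]
      have := mul_le_mul sqrt_three_le_two h2 (sub_nonneg.2 (Complex.re_le_norm z)) (by norm_num)
      linarith
    rw [← sq_abs (Real.cos _)]
    nlinarith [sq_nonneg (Real.sinh (Real.sqrt 3 * z.im))]

theorem norm_sin_le (w : ℂ) : ‖Complex.sin w‖ ≤ 1 + ‖Complex.cos w‖ := by
  have h : Complex.sin w ^ 2 = 1 - Complex.cos w ^ 2 := by
    linear_combination Complex.sin_sq_add_cos_sq w
  have h1 := norm_sub_le (1 : ℂ) (Complex.cos w ^ 2)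
  rw [← h, norm_pow, norm_pow, norm_one] at h1
  nlinarith [norm_nonneg (Complex.cos w), norm_nonneg (Complex.sin w)]

theorem cosExpFun_bound_of_re {m : ℕ} (hm : 1 ≤ m) {z : ℂ}
    (hz : ‖z‖ = m * (Real.pi / Real.sqrt 3)) (hre : ‖z‖ ≤ 2 * z.re) :
    cosExpFun z ≠ 0 ∧ ‖deriv cosExpFun z‖ ≤ 18 * ‖cosExpFun z‖ := by
  have hR : 1 ≤ ‖z‖ := by
    have hm' : (1 : ℝ) ≤ m := by exact_mod_cast hm
    rw [hz]
    nlinarith [one_le_pi_div_sqrt_three]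
  have hc := half_le_norm_cos hm hz hre
  have hsin := norm_sin_le (Real.sqrt 3 * z)
  have hexp : Complex.exp (3 * z) * Complex.exp (-3 * z) = 1 := by
    rw [← Complex.exp_add]; simp
  have hf : cosExpFun z = 2 * Complex.exp (3 * z) *
      (Complex.cos (Real.sqrt 3 * z) + Complex.exp (-3 * z) / 2) := by
    unfold cosExpFun
    linear_combination -hexp
  have hE : ‖Complex.exp (-3 * z) / 2‖ ≤ 1 / 4 := by
    rw [norm_div, Complex.norm_exp, Complex.norm_ofNat]
    have e : (-3 * z).re = -(3 * z.re) := by simp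
    rw [e, Real.exp_neg]
    have h1 := Real.add_one_le_exp (3 * z.re)
    have h2 : (Real.exp (3 * z.re))⁻¹ ≤ 2⁻¹ := inv_anti₀ (by norm_num) (by linarith)
    linarith
  set c := Complex.cos (Real.sqrt 3 * z)
  set s := Complex.sin (Real.sqrt 3 * z)
  have hden : ‖c‖ / 2 ≤ ‖c + Complex.exp (-3 * z) / 2‖ := by
    have := norm_sub_le_norm_add c (Complex.exp (-3 * z) / 2)
    linarith
  -- 3|c| + 2(1 + |c|) ≤ 9|c| because |c| ≥ 1/2; dividing by the |c|/2 of `hden` yields the 18.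
  have hnum : ‖3 * c - Real.sqrt 3 * s‖ ≤ 9 * ‖c‖ := by
    have h1 := norm_sub_le (3 * c) (Real.sqrt 3 * s)
    rw [norm_mul, norm_mul, Complex.norm_real, Complex.norm_ofNat, Real.norm_of_nonneg
      (Real.sqrt_nonneg 3)] at h1
    have h2 := mul_le_mul_of_nonneg_right sqrt_three_le_two (norm_nonneg s)
    linarith
  have hne : c + Complex.exp (-3 * z) / 2 ≠ 0 := by
    rw [← norm_pos_iff]; linarith
  refine ⟨?_, ?_⟩
  · rw [hf]
    exact mul_ne_zero (mul_ne_zero two_ne_zero (Complex.exp_ne_zero _)) hne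
  · rw [(hasDerivAt_cosExpFun z).deriv, hf, norm_mul, norm_mul _ (c + _), mul_left_comm]
    exact mul_le_mul_of_nonneg_left (by linarith) (norm_nonneg _)

/-- Rotate into the sector; 20 is 18 plus 2, the logarithmic derivative of e^{2z}. -/
theorem norm_logDeriv_expCubeSum_le {m : ℕ} (hm : 1 ≤ m) {z : ℂ}
    (hz : ‖z‖ = m * (Real.pi / Real.sqrt 3)) :
    expCubeSum z ≠ 0 ∧ ‖logDeriv expCubeSum z‖ ≤ 20 := by
  obtain ⟨k, -, hre⟩ := exists_norm_le_two_mul_re z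
  set w := cubeRootUnity ^ k * z with hw
  have hnw : ‖w‖ = ‖z‖ := by
    rw [hw, norm_mul, norm_pow, norm_cubeRootUnity, one_pow, one_mul]
  obtain ⟨h1, h2⟩ := cosExpFun_bound_of_re hm (hnw.trans hz) (hnw.trans_le hre)
  have h3 : expCubeSum w ≠ 0 := fun e => h1 ((cosExpFun_eq_zero_iff w).2 e)
  have h4 : ‖deriv expCubeSum w‖ ≤ 20 * ‖expCubeSum w‖ := by
    have e : Complex.exp (2 * w) * deriv expCubeSum w = deriv cosExpFun w - 2 * cosExpFun w := by
      rw [deriv_cosExpFun_eq]; ring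
    have h5 := norm_sub_le (deriv cosExpFun w) (2 * cosExpFun w)
    rw [← e, norm_mul 2, Complex.norm_ofNat] at h5
    have h6 : ‖Complex.exp (2 * w)‖ * ‖deriv expCubeSum w‖ ≤
        ‖Complex.exp (2 * w)‖ * (20 * ‖expCubeSum w‖) := by
      rw [← norm_mul, mul_left_comm ‖_‖, ← norm_mul (Complex.exp _) (expCubeSum w), ← cosExpFun_eq]
      linarith
    exact le_of_mul_le_mul_left h6 (norm_pos_iff.2 (Complex.exp_ne_zero _))
  rw [hw, expCubeSum_pow_mul] at h3
  refine ⟨h3, ?_⟩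
  rw [logDeriv_apply, norm_div, div_le_iff₀ (norm_pos_iff.2 h3), ← deriv_expCubeSum_pow_mul k,
    norm_mul, norm_pow, norm_cubeRootUnity, one_pow, one_mul, ← expCubeSum_pow_mul k z]
  exact h4

/-! ### Taylor coefficients at the origin -/

theorem iteratedDeriv_expCubeSum_zero (n : ℕ) : iteratedDeriv n expCubeSum 0 =
    (-2) ^ n * (1 + cubeRootUnity ^ n + (cubeRootUnity ^ 2) ^ n) := by
  have h (c : ℂ) : ContDiffAt ℂ n (fun z => Complex.exp (c * z)) 0 := by fun_prop
  unfold expCubeSum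
  rw [iteratedDeriv_fun_add ((h _).add (h _)) (h _), iteratedDeriv_fun_add (h _) (h _)]
  simp only [iteratedDeriv_cexp_const_mul, mul_zero, Complex.exp_zero, mul_one]
  ring

theorem iteratedDeriv_five_logDeriv_expCubeSum :
    iteratedDeriv 5 (logDeriv expCubeSum) 0 = -576 := by
  have hne : expCubeSum 0 ≠ 0 := by rw [expCubeSum_zero]; norm_num
  have hG := differentiable_expCubeSum
  have hA (n : ℕ) : ContDiffAt ℂ n (logDeriv expCubeSum) 0 :=
    hG.contDiff.differentiable_deriv_two.contDiff.contDiffAt.div hG.contDiff.contDiffAt hne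
  have hev : logDeriv expCubeSum * expCubeSum =ᶠ[nhds 0] deriv expCubeSum := by
    filter_upwards [hG.continuous.continuousAt.eventually_ne hne] with z hz
    rw [Pi.mul_apply, logDeriv_apply, div_mul_cancel₀ _ hz]
  -- Leibniz's rule for (F'/F)·F = F'. Only derivatives of F of order divisible by 3 survive at 0,
  -- so with L = F'/F orders 2 and 5 read 3L'' = -24 and 3L⁽⁵⁾ - 240L'' = 192.
  have key (n : ℕ) : ∑ i ∈ Finset.range (n + 1), (n.choose i : ℂ) *
      iteratedDeriv i (logDeriv expCubeSum) 0 * iteratedDeriv (n - i) expCubeSum 0 =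
      iteratedDeriv (n + 1) expCubeSum 0 := by
    rw [← iteratedDeriv_mul (hA n) hG.contDiff.contDiffAt, hev.iteratedDeriv_eq,
      iteratedDeriv_succ']
  have h3 := cubeRootUnity_pow_three
  have h1 : 1 + cubeRootUnity + cubeRootUnity ^ 2 = 0 := by
    rw [cubeRootUnity_sq, cubeRootUnity_eq]; ring
  have h4 : cubeRootUnity ^ 4 = cubeRootUnity := by linear_combination cubeRootUnity * h3
  have d0 : iteratedDeriv 0 expCubeSum 0 = 3 := by
    rw [iteratedDeriv_expCubeSum_zero]; norm_num
  have d1 : iteratedDeriv 1 expCubeSum 0 = 0 := by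
    rw [iteratedDeriv_expCubeSum_zero]; linear_combination -2 * h1
  have d2 : iteratedDeriv 2 expCubeSum 0 = 0 := by
    rw [iteratedDeriv_expCubeSum_zero]; linear_combination 4 * h1 + 4 * h4
  have d3 : iteratedDeriv 3 expCubeSum 0 = -24 := by
    rw [iteratedDeriv_expCubeSum_zero]
    linear_combination -8 * (2 + cubeRootUnity ^ 3) * h3
  have d6 : iteratedDeriv 6 expCubeSum 0 = 192 := by
    rw [iteratedDeriv_expCubeSum_zero]
    linear_combination 64 * (2 + 2 * cubeRootUnity ^ 3 + cubeRootUnity ^ 6 + cubeRootUnity ^ 9) * h3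
  have d4 : iteratedDeriv 4 expCubeSum 0 = 0 := by
    rw [iteratedDeriv_expCubeSum_zero]
    linear_combination 16 * h1 + 16 * h4 + 16 * (cubeRootUnity ^ 5 + cubeRootUnity ^ 2) * h3
  have d5 : iteratedDeriv 5 expCubeSum 0 = 0 := by
    rw [iteratedDeriv_expCubeSum_zero]
    linear_combination -32 * h1 - 32 * (cubeRootUnity ^ 2 + cubeRootUnity ^ 7 + cubeRootUnity ^ 4 +
      cubeRootUnity) * h3
  have k0 := key 0
  have k1 := key 1
  have k2 := key 2
  have k5 := key 5
  simp only [Finset.sum_range_succ, Finset.sum_range_zero, d0, d1, d2, d3, d4, d5, d6,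
    Nat.reduceAdd, Nat.reduceSub, Nat.sub_zero, zero_add, Nat.choose, Nat.cast_one, one_mul,
    mul_zero, add_zero] at k0 k1 k2 k5
  norm_num at k0 k1 k2 k5
  linear_combination k5 / 3 + (80 / 3) * k2

theorem isPrimitiveRoot_cubeRootUnity : IsPrimitiveRoot cubeRootUnity 3 := by
  simpa [cubeRootUnity] using Complex.isPrimitiveRoot_exp 3 (by norm_num)

/-! ### Evaluation of the sum -/

/-- The zeros of `expCubeSum` of modulus less than `m π / √3`. -/
noncomputable def zeroFinset (m : ℕ) : Finset ℂ :=
  (Finset.range 3 ×ˢ Finset.range m).image fun p => cubeRootUnity ^ p.1 * (realRoot p.2 : ℂ)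

theorem norm_pow_mul_realRoot (k n : ℕ) :
    ‖cubeRootUnity ^ k * (realRoot n : ℂ)‖ = realRoot n := by
  rw [norm_mul, norm_pow, norm_cubeRootUnity, one_pow, one_mul, Complex.norm_real,
    Real.norm_of_nonneg (realRoot_pos n).le]

theorem mem_zeroFinset {m : ℕ} {z : ℂ} : z ∈ zeroFinset m ↔
    ∃ k < 3, ∃ n < m, cubeRootUnity ^ k * (realRoot n : ℂ) = z := by
  simp [zeroFinset, and_assoc]

theorem card_zeroFinset_le (m : ℕ) : (zeroFinset m).card ≤ 3 * m :=
  Finset.card_image_le.trans (by simp)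

theorem sum_zeroFinset (m : ℕ) : ∑ ρ ∈ zeroFinset m, (ρ ^ 6)⁻¹ =
    ((3 * ∑ n ∈ Finset.range m, realRoot n ^ (-6 : ℤ) : ℝ) : ℂ) := by
  have hinj : Set.InjOn (fun p : ℕ × ℕ => cubeRootUnity ^ p.1 * (realRoot p.2 : ℂ))
      (Finset.range 3 ×ˢ Finset.range m : Finset (ℕ × ℕ)) := by
    rintro ⟨k, n⟩ hp ⟨k', n'⟩ hp' h
    have hn := congrArg norm h
    simp only [norm_pow_mul_realRoot] at hn
    obtain rfl := strictMono_realRoot.injective hn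
    have h0 : (realRoot n : ℂ) ≠ 0 := by exact_mod_cast (realRoot_pos n).ne'
    have hk := mul_right_cancel₀ h0 h
    simp at hp hp'
    rw [isPrimitiveRoot_cubeRootUnity.pow_inj hp.1 hp'.1 hk]
  rw [zeroFinset, Finset.sum_image hinj, Finset.sum_product]
  have h (k n : ℕ) : ((cubeRootUnity ^ k * (realRoot n : ℂ)) ^ 6)⁻¹ =
      ((realRoot n ^ (-6 : ℤ) : ℝ) : ℂ) := by
    have e : (cubeRootUnity ^ k) ^ 6 = 1 := by
      rw [← pow_mul, show k * 6 = 3 * (2 * k) by ring, pow_mul, cubeRootUnity_pow_three, one_pow]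
    rw [mul_pow, e, one_mul]
    push_cast
    rw [zpow_neg]
    norm_cast
  simp only [h, Finset.sum_const, Finset.card_range]
  push_cast
  rw [nsmul_eq_mul]
  norm_num

theorem abs_sum_realRoot_sub_le {m : ℕ} (hm : 1 ≤ m) :
    |∑ n ∈ Finset.range m, realRoot n ^ (-6 : ℤ) - 8 / 5| ≤ 11 / m := by
  have hm' : (1 : ℝ) ≤ m := by exact_mod_cast hm
  have hR : (m : ℝ) ≤ m * (Real.pi / Real.sqrt 3) := by
    nlinarith [one_le_pi_div_sqrt_three]
  have hmain := norm_iteratedDeriv_logDeriv_add_sum_le differentiable_expCubeSum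
    (by rw [expCubeSum_zero]; norm_num) 5 (R := m * (Real.pi / Real.sqrt 3)) (C := 20) (d := 1 / 4)
    (by linarith) (by norm_num) (zeroFinset m) ?_ ?_
    (fun z hz => norm_logDeriv_expCubeSum_le hm hz) ?_
  · rw [iteratedDeriv_five_logDeriv_expCubeSum, sum_zeroFinset] at hmain
    set s := ∑ n ∈ Finset.range m, realRoot n ^ (-6 : ℤ)
    have e : (-576 + (Nat.factorial 5 : ℂ) * ((3 * s : ℝ) : ℂ)) = ((360 * (s - 8 / 5) : ℝ) : ℂ) := by
      push_cast [Nat.factorial]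
      ring
    rw [e, Complex.norm_real, norm_mul, Real.norm_eq_abs, Real.norm_eq_abs] at hmain
    have hcard : ((zeroFinset m).card : ℝ) ≤ 3 * m := by exact_mod_cast card_zeroFinset_le m
    -- At most 3m zeros at distance at least 1/4 contribute 12m, and 20 + 12m ≤ 32m. Dividing 120·32
    -- by 360 = 3·5! gives less than 11.
    have h1 : (Nat.factorial 5 : ℝ) * (20 + (zeroFinset m).card / (1 / 4)) /
        (m * (Real.pi / Real.sqrt 3)) ^ 5 ≤ 120 * (32 * m) / m ^ 5 := by
      gcongr
      · norm_num [Nat.factorial]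
      · linarith
    have h2 : 120 * (32 * (m : ℝ)) / m ^ 5 ≤ 120 * 32 / m := by
      rw [div_le_div_iff₀ (by positivity) (by positivity)]
      have : (m : ℝ) ^ 2 ≤ m ^ 5 := pow_le_pow_right₀ hm' (by norm_num)
      linarith
    have h3 : 120 * 32 / (m : ℝ) ≤ 360 * (11 / m) := by
      rw [← mul_div_assoc]
      exact div_le_div_of_nonneg_right (by norm_num) (by linarith)
    have h4 : |(360 : ℝ)| = 360 := abs_of_nonneg (by norm_num)
    rw [h4] at hmain
    linarith
  · intro ρ hρ
    obtain ⟨k, -, n, -, rfl⟩ := mem_zeroFinset.1 hρ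
    have h0 : expCubeSum (cubeRootUnity ^ k * (realRoot n : ℂ)) = 0 := by
      rw [expCubeSum_pow_mul, ← cosExpFun_eq_zero_iff, cosExpFun_realRoot]
    exact ⟨h0, deriv_expCubeSum_ne_zero h0⟩
  · intro z hz h0
    obtain ⟨n, hn⟩ := (cosExpFun_eq_zero_iff_exists z).1 ((cosExpFun_eq_zero_iff z).2 h0)
    have hk : ∃ k < 3, cubeRootUnity ^ k * (realRoot n : ℂ) = z := by
      rcases hn with rfl | rfl | rfl
      · exact ⟨0, by norm_num, by simp⟩
      · exact ⟨1, by norm_num, by simp⟩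
      · exact ⟨2, by norm_num, rfl⟩
    obtain ⟨k, hk, rfl⟩ := hk
    refine mem_zeroFinset.2 ⟨k, hk, n, ?_, rfl⟩
    rw [norm_pow_mul_realRoot] at hz
    have h1 := lt_of_mul_lt_mul_right ((realRoot_mem n).1.trans_le hz) pi_div_sqrt_three_pos.le
    exact_mod_cast h1
  · intro z hz ρ hρ
    obtain ⟨k, -, n, -, rfl⟩ := mem_zeroFinset.1 hρ
    have h1 := abs_norm_sub_norm_le z (cubeRootUnity ^ k * (realRoot n : ℂ))
    rw [norm_pow_mul_realRoot, hz] at h1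
    exact (quarter_le_abs_sub_realRoot m n).trans h1

theorem hasSum_realRoot : HasSum (fun n : ℕ => realRoot n ^ (-6 : ℤ)) (8 / 5) := by
  rw [hasSum_iff_tendsto_nat_of_nonneg fun n => zpow_nonneg (realRoot_pos n).le _,
    tendsto_iff_norm_sub_tendsto_zero]
  refine squeeze_zero' (Filter.Eventually.of_forall fun _ => norm_nonneg _) ?_
    (tendsto_const_div_atTop_nhds_zero_nat 11)
  filter_upwards [Filter.eventually_ge_atTop 1] with m hm
  exact abs_sum_realRoot_sub_le hm

theorem mainTheorem2 :
    ∃ r : ℕ → ℝ,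
      StrictMono r ∧
      Set.range r = {x : ℝ | 2 * Real.cos (Real.sqrt 3 * x) = -Real.exp (-3 * x)} ∧
      (∀ n, 0 < r n) ∧
      HasSum (fun n : ℕ => r n ^ (-6 : ℤ)) (8 / 5) ∧
      {z : ℂ | cosExpFun z = 0} =
        {z : ℂ | ∃ n : ℕ, z = (r n : ℂ) ∨ z = cubeRootUnity * (r n : ℂ) ∨
          z = cubeRootUnity ^ 2 * (r n : ℂ)} ∧
      (∀ z : ℂ, cosExpFun z = 0 → analyticOrderAt cosExpFun z = 1) :=
  ⟨realRoot, strictMono_realRoot, range_realRoot, realRoot_pos, hasSum_realRoot,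
    Set.ext cosExpFun_eq_zero_iff_exists, fun _ h => analyticOrderAt_cosExpFun h⟩
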